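/- Let $\mathcal A$ be a locally noetherian Grothendieck category, i.e. a Grothendieck category with a generating set of noetherian objects, and let $\operatorname{noeth}\mathcal A$ be its full subcategory of noetherian objects. Definitions. A full subcategory of $\mathcal A$ is a nullity class if it is closed under quotients and extensions, and a torsion class if it is moreover closed under arbitrary direct sums. For an object $M$, let $\overline{C(M)}$ be the smallest nullity class containing $M$. For a full subcategory $\mathcal S$, let $\overrightarrow{\mathcal S}$ be the full subcategory of all direct limits $\varinjlim X_i$ (over directed sets) with all $X_i\in\mathcal S$. A torsion class $\mathcal T$ is of weakly finite type if $\mathcal T=\overrightarrow{\mathcal T\cap\operatorname{noeth}\mathcal A}$. A nonzero object $H$ is premonoform if no quotient $H/N$ with $0\neq N\subsetneq H$ is isomorphic to a subobject of $H$. Premonoform objects $H,G$ are equivalent if $\overline{C(H)}=\overline{C(G)}$; $[H]$ is the equivalence class of $H$ and $\operatorname{PSpec}\mathcal A$ is the collection of these classes. For an object $M$ put $\operatorname{PSupp}M=\{[H]\in\operatorname{PSpec}\mathcal A : H\in\overline{C(M)}\}$. Topologize $\operatorname{PSpec}\mathcal A$ by declaring $\Phi$ closed if $\operatorname{PSupp}H\subseteq\Phi$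 for every $[H]\in\Phi$. Let $\operatorname{nPSpec}\mathcal A\subseteq\operatorname{PSpec}\mathcal A$ be the subspace of the classes represented by noetherian premonoform objects. For an object $M$ and a full subcategory $\mathcal X$ put $\operatorname{nPSupp}M=\operatorname{nPSpec}\mathcal A\cap\operatorname{PSupp}M$ and $\operatorname{nPSupp}\mathcal X=\bigcup_{M\in\mathcal X}\operatorname{nPSupp}M$; for $\Phi\subseteq\operatorname{nPSpec}\mathcal A$ put $\operatorname{nPSupp}^{-1}\Phi=\{M\in\mathcal A : \operatorname{nPSupp}M\subseteq\Phi\}$. The subset $\Phi$ is extension-closed if $\operatorname{nPSupp}^{-1}\Phi$ is closed under extensions. Theorem. The map $\mathcal X\mapsto\operatorname{nPSupp}\mathcal X$ is a bijection from the torsion classes of weakly finite type of $\mathcal A$ onto the closed and extension-closed subsets of $\operatorname{nPSpec}\mathcal A$. Its inverse is $\Phi\mapsto\overrightarrow{\operatorname{nPSupp}^{-1}\Phi\cap\operatorname{noeth}\mathcal A}$. -/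

import Mathlib

open CategoryTheory CategoryTheory.Limits

universe w v u

namespace PremonoformSpectrum

section Abelian

variable {C : Type u} [Category.{v} C] [Abelian C]

/-- A nullity class: a full subcategory closed under quotients and extensions. -/
structure IsNullityClass (P : ObjectProperty C) : Prop where
  quotients : P.IsClosedUnderQuotients
  extensions : P.IsClosedUnderExtensions

/-- The smallest nullity class containing the object `M`. -/
def nullityClosure (M : C) : ObjectProperty C :=
  fun N => ∀ P : ObjectProperty C, IsNullityClass P → P M → P N

/-- A torsion class: a nullity class closed under arbitrary (`w`-small) direct sums. -/
structure IsTorsionClass (P : ObjectProperty C) : Prop where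
  nullity : IsNullityClass P
  coproducts : ∀ J : Type w, P.IsClosedUnderColimitsOfShape (Discrete J)

/-- The full subcategory of all direct limits, over (`w`-small) directed sets,
of objects satisfying `P`. -/
def directLimits (P : ObjectProperty C) : ObjectProperty C :=
  fun X => ∃ (J : Type w) (_ : Preorder J) (_ : IsDirectedOrder J) (_ : Nonempty J),
    P.colimitsOfShape J X

/-- A full subcategory `P` is of weakly finite type if it consists exactly of the direct limits
of noetherian objects lying in `P`. -/
def IsOfWeaklyFiniteType (P : ObjectProperty C) : Prop :=
  P = directLimits.{w} (P ⊓ isNoetherianObject)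

/-- A nonzero object `H` is premonoform if no quotient `H/N` other than `0` and `H` itself
is (isomorphic to) a subobject of `H`. -/
def IsPremonoform (H : C) : Prop :=
  ¬ IsZero H ∧ ∀ N : Subobject H, (∃ i : cokernel N.arrow ⟶ H, Mono i) → N = ⊥ ∨ N = ⊤

variable (C) in
/-- Two premonoform objects are equivalent if they generate the same nullity class. -/
def premonoformSetoid : Setoid {H : C // IsPremonoform H} where
  r H G := nullityClosure H.1 = nullityClosure G.1
  iseqv := ⟨fun _ => rfl, fun h => h.symm, fun h h' => h.trans h'⟩

variable (C) in
/-- The pspectrum of `C`: the equivalence classes of premonoform objects. -/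
def PSpec : Type u := Quotient (premonoformSetoid C)

/-- The class `[H]` of a premonoform object `H`. -/
def PSpec.mk (H : C) (hH : IsPremonoform H) : PSpec C :=
  Quotient.mk (premonoformSetoid C) ⟨H, hH⟩

/-- The psupport of `M`: the classes `[H]` with `H` in the nullity class generated by `M`. -/
def psupp (M : C) : Set (PSpec C) :=
  {p | ∃ (H : C) (hH : IsPremonoform H), p = PSpec.mk H hH ∧ nullityClosure M H}

theorem nullityClosure_self (M : C) : nullityClosure M M := fun _ _ h => h

theorem nullityClosure_trans {M N K : C} (h : nullityClosure M N) (h' : nullityClosure N K) :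
    nullityClosure M K := fun P hP hM => h' P hP (h P hP hM)

theorem PSpec.mk_eq_mk_iff {H G : C} {hH : IsPremonoform H} {hG : IsPremonoform G} :
    PSpec.mk H hH = PSpec.mk G hG ↔ nullityClosure H = nullityClosure G :=
  Quotient.eq (r := premonoformSetoid C)

theorem PSpec.mk_mem_psupp_iff {M H : C} (hH : IsPremonoform H) :
    PSpec.mk H hH ∈ psupp M ↔ nullityClosure M H := by
  constructor
  · rintro ⟨G, hG, e, hMG⟩
    rw [PSpec.mk_eq_mk_iff] at e
    exact nullityClosure_trans hMG (e ▸ nullityClosure_self H)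
  · exact fun h => ⟨H, hH, rfl, h⟩

/-- The topology on the pspectrum: `Φ` is closed if `psupp H ⊆ Φ` for every `[H] ∈ Φ`. -/
instance : TopologicalSpace (PSpec C) :=
  TopologicalSpace.ofClosed
    {Φ | ∀ (H : C) (hH : IsPremonoform H), PSpec.mk H hH ∈ Φ → psupp H ⊆ Φ}
    (fun _ _ h => h.elim)
    (fun _ hA H hH h _ hp Φ hΦ => hA hΦ H hH (h Φ hΦ) hp)
    (fun _ hA _ hB H hH h _ hp => h.imp (fun h => hA H hH h hp) (fun h => hB H hH h hp))

theorem PSpec.isClosed_iff (Φ : Set (PSpec C)) :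
    IsClosed Φ ↔ ∀ (H : C) (hH : IsPremonoform H), PSpec.mk H hH ∈ Φ → psupp H ⊆ Φ := by
  rw [← isOpen_compl_iff]
  change Φᶜᶜ ∈ {Ψ : Set (PSpec C) | _} ↔ _
  rw [compl_compl]
  rfl

variable (C) in
/-- The classes represented by a noetherian premonoform object, as a subspace of the
pspectrum. -/
abbrev NPSpec : Type u :=
  {p : PSpec C // ∃ (H : C) (hH : IsPremonoform H), IsNoetherianObject H ∧ p = PSpec.mk H hH}

/-- `nPSupp M`: the part of the psupport of `M` lying in `NPSpec C`. -/
def npsupp (M : C) : Set (NPSpec C) := {p | p.1 ∈ psupp M}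

/-- `nPSupp` of a full subcategory: the union of the `nPSupp` of its objects. -/
def npsuppOf (P : ObjectProperty C) : Set (NPSpec C) := {p | ∃ M : C, P M ∧ p ∈ npsupp M}

/-- `nPSupp⁻¹ Φ`: the full subcategory of the objects `M` with `nPSupp M ⊆ Φ`. -/
def npsuppInv (Φ : Set (NPSpec C)) : ObjectProperty C := fun M => npsupp M ⊆ Φ

theorem NPSpec.isClosed_iff (Φ : Set (NPSpec C)) :
    IsClosed Φ ↔ ∀ p ∈ Φ, ∀ (H : C) (hH : IsPremonoform H), p.1 = PSpec.mk H hH →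
      npsupp H ⊆ Φ := by
  rw [isClosed_induced_iff]
  constructor
  · rintro ⟨Ψ, hΨ, rfl⟩ p hp H hH e q hq
    exact (PSpec.isClosed_iff Ψ).1 hΨ H hH (e ▸ hp) hq
  · intro h
    refine ⟨{q | ∃ p ∈ Φ, ∃ (H : C) (hH : IsPremonoform H), p.1 = PSpec.mk H hH ∧ q ∈ psupp H},
      (PSpec.isClosed_iff _).2 ?_, ?_⟩
    · rintro H hH ⟨p, hp, G, hG, e, hGH⟩ _ ⟨K, hK, rfl, hHK⟩
      rw [PSpec.mk_mem_psupp_iff] at hGH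
      exact ⟨p, hp, G, hG, e, (PSpec.mk_mem_psupp_iff hK).2 (nullityClosure_trans hGH hHK)⟩
    · ext q
      constructor
      · rintro ⟨p, hp, H, hH, e, hq⟩
        exact h p hp H hH e hq
      · intro hq
        obtain ⟨H, hH, -, e⟩ := q.2
        exact ⟨q, hq, H, hH, e, e ▸ (PSpec.mk_mem_psupp_iff hH).2 (nullityClosure_self H)⟩

/-- `Φ` is extension-closed if `nPSupp⁻¹ Φ` is closed under extensions. -/
def IsExtensionClosed (Φ : Set (NPSpec C)) : Prop := (npsuppInv Φ).IsClosedUnderExtensions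

/-- `C` has a (`w`-small) generating set of noetherian objects. For a Grothendieck category, this
says that it is locally noetherian. -/
def IsLocallyNoetherian (C : Type u) [Category.{v} C] [Abelian C] : Prop :=
  ∃ (ι : Type w) (G : ι → C), (∀ i, IsNoetherianObject (G i)) ∧
    (ObjectProperty.ofObj G).IsSeparating

end Abelian

end PremonoformSpectrum

open PremonoformSpectrum

/-! Both sides are governed by nonempty nullity classes `P` of noetherian objects. For such `P`,
direct limits of objects of `P` are the objects generated by `P` (`directLimits_eq_generatedBy`).
They form a torsion class (`isTorsionClass_directLimits`) whose noetherian part is again `P`, so a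
torsion class of weakly finite type amounts to its noetherian part. Supports recover noetherian
parts. A noetherian object outside a nullity class has a quotient that is minimally outside it, and
such a quotient is premonoform (`exists_isPremonoform_quotient`). Hence `npsuppInv (npsuppOf P)`
consists of the objects whose noetherian quotients all lie in `P` (`npsuppInv_npsuppOf`), a nullity
class with the same noetherian objects as `P`. Conversely, closedness of `Φ` puts each noetherian
`H` with `[H] ∈ Φ` into `npsuppInv Φ`. -/

namespace PremonoformSpectrum

/-! ### Noetherian objects form a nullity class -/

section Noetherian

variable {C : Type u} [Category.{v} C] [Abelian C]

theorem subobject_factors_iff {X Y : C} (Z : Subobject X) (f : Y ⟶ X) :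
    Z.Factors f ↔ f ≫ cokernel.π Z.arrow = 0 := by
  constructor
  · intro h
    rw [← Z.factorThru_arrow f h, Category.assoc, cokernel.condition, comp_zero]
  · intro h
    rw [← Abelian.monoLift_comp Z.arrow f h]
    exact Subobject.factors_comp_arrow _

theorem subobject_factors_of_epi_comp {X Y T : C} (Z : Subobject X) (p : T ⟶ Y) [Epi p]
    (f : Y ⟶ X) (h : Z.Factors (p ≫ f)) : Z.Factors f := by
  rw [subobject_factors_iff] at h ⊢
  rwa [← cancel_epi p, comp_zero, ← Category.assoc]

/-- Pulling back subobjects along an epimorphism is injective, because epimorphisms are stable under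
pullback. -/
theorem isNoetherianObject_of_epi {X Y : C} (f : X ⟶ Y) [Epi f] (hX : isNoetherianObject X) :
    isNoetherianObject Y := by
  have : WellFoundedGT (Subobject X) := hX
  refine StrictMono.wellFoundedGT (β := Subobject X) (f := (Subobject.pullback f).obj)
    ((Subobject.pullback f).monotone.strictMono_of_injective ?_)
  have key : ∀ Z Z' : Subobject Y,
      (Subobject.pullback f).obj Z = (Subobject.pullback f).obj Z' → Z ≤ Z' := by
    intro Z Z' h
    have sq := Subobject.isPullback f Z
    have : Epi (Subobject.pullbackπ f Z) :=
      (MorphismProperty.epimorphisms C).of_isPullback sq.flip ‹Epi f›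
    refine Subobject.le_of_factors (subobject_factors_of_epi_comp Z' (Subobject.pullbackπ f Z) _ ?_)
    rw [sq.w, ← Limits.pullback_factors_iff, ← h]
    exact Subobject.factors_self _
  exact fun Z Z' h => le_antisymm (key _ _ h) (key _ _ h.symm)

theorem imageSubobject_factors_iff {X Y T : C} (f : X ⟶ Y) (t : T ⟶ Y) :
    (imageSubobject f).Factors t ↔
      ∃ (T' : C) (p : T' ⟶ T) (_ : Epi p) (x : T' ⟶ X), p ≫ t = x ≫ f := by
  constructor
  · intro h
    obtain ⟨T', p, hp, x, hx⟩ := surjective_up_to_refinements_of_epi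
      (factorThruImageSubobject f) ((imageSubobject f).factorThru t h)
    refine ⟨T', p, hp, x, ?_⟩
    rw [← Subobject.factorThru_arrow _ t h, reassoc_of% hx, imageSubobject_arrow_comp]
  · rintro ⟨T', p, hp, x, hx⟩
    refine subobject_factors_of_epi_comp _ p t ?_
    rw [hx]
    exact imageSubobject_factors_comp_self _ _

/-- A subobject `Z` of the middle term is determined, among comparable ones, by its trace on `S.X₁`
and its image in `S.X₃`. -/
theorem isNoetherianObject_of_shortExact {S : ShortComplex C} (hS : S.ShortExact)
    (h₁ : isNoetherianObject S.X₁) (h₃ : isNoetherianObject S.X₃) : isNoetherianObject S.X₂ := by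
  have : WellFoundedGT (Subobject S.X₁) := h₁
  have : WellFoundedGT (Subobject S.X₃) := h₃
  have := hS.mono_f
  let φ : Subobject S.X₂ → Subobject S.X₁ × Subobject S.X₃ := fun Z =>
    ((Subobject.pullback S.f).obj Z, imageSubobject (Z.arrow ≫ S.g))
  refine StrictMono.wellFoundedGT (f := φ) fun Z Z' hZ => lt_of_le_of_ne ⟨?_, ?_⟩ fun h => ?_
  · exact (Subobject.pullback S.f).monotone hZ.le
  · dsimp only [φ]
    rw [← Subobject.ofLE_arrow hZ.le, Category.assoc]
    exact imageSubobject_comp_le _ _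
  · refine hZ.not_ge (Subobject.le_of_factors ?_)
    obtain ⟨e₁, e₃⟩ := Prod.ext_iff.1 h
    dsimp only [φ] at e₁ e₃
    have h' : (imageSubobject (Z'.arrow ≫ S.g)).Factors (Z'.arrow ≫ S.g) := by
      simpa using imageSubobject_factors_comp_self (f := Z'.arrow ≫ S.g) (𝟙 _)
    rw [← e₃, imageSubobject_factors_iff] at h'
    obtain ⟨T, p, hp, x, hx⟩ := h'
    -- An element of `Z'` and one of `Z` with the same image differ by an element of `S.X₁` lying in
    -- `Z'`, hence in `Z` by equality of traces.
    obtain ⟨T', q, hq, y, hy⟩ := hS.exact.exact_up_to_refinements (p ≫ Z'.arrow - x ≫ Z.arrow)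
      (by simp [Preadditive.sub_comp, hx])
    have hy' : Z.Factors (y ≫ S.f) := by
      rw [← Limits.pullback_factors_iff, e₁, Limits.pullback_factors_iff, ← hy,
        Preadditive.comp_sub, sub_eq_add_neg]
      refine Subobject.factors_add _ _ ?_ ?_
      · rw [← Category.assoc]; exact Subobject.factors_comp_arrow _
      · rw [← Subobject.ofLE_arrow hZ.le, ← Category.assoc, ← Category.assoc,
          ← Preadditive.neg_comp]
        exact Subobject.factors_comp_arrow _
    refine subobject_factors_of_epi_comp Z (q ≫ p) _ ?_
    have : (q ≫ p) ≫ Z'.arrow = y ≫ S.f + (q ≫ x) ≫ Z.arrow := by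
      rw [← hy]; simp
    rw [this]
    exact Subobject.factors_add _ _ hy' (Subobject.factors_comp_arrow _)

theorem isNullityClass_isNoetherianObject : IsNullityClass (isNoetherianObject (C := C)) where
  quotients := ⟨fun f _ h => isNoetherianObject_of_epi f h⟩
  extensions := ⟨fun hS h₁ h₃ => isNoetherianObject_of_shortExact hS h₁ h₃⟩

/-- If the components of a cocone over a filtered diagram are jointly epimorphic and its point is
noetherian, then one of the components is an epimorphism. -/
theorem exists_epi_of_isNoetherianObject {J : Type*} [Category* J] [IsFiltered J] {F : J ⥤ C}
    (c : Cocone F) (hc : isNoetherianObject c.pt)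
    (h : ∀ {Z : C} (g : c.pt ⟶ Z), (∀ j, c.ι.app j ≫ g = 0) → g = 0) :
    ∃ j, Epi (c.ι.app j) := by
  have : WellFoundedGT (Subobject c.pt) := hc
  have := IsFiltered.nonempty (C := J)
  let I : J → Subobject c.pt := fun j => imageSubobject (c.ι.app j)
  have hI : ∀ {i j : J} (_ : i ⟶ j), I i ≤ I j := fun {i j} f => by
    dsimp only [I]
    rw [← c.w f]
    exact imageSubobject_comp_le _ _
  obtain ⟨_, ⟨j₀, rfl⟩, hj₀⟩ := (wellFounded_gt (α := Subobject c.pt)).has_min (Set.range I)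
    (Set.range_nonempty I)
  -- A maximal image in a directed family is the largest one.
  have hmax : ∀ j, I j ≤ I j₀ := fun j =>
    (hI (IsFiltered.leftToMax j j₀)).trans_eq
      ((hI (IsFiltered.rightToMax j j₀)).eq_of_not_lt (hj₀ _ ⟨_, rfl⟩)).symm
  refine ⟨j₀, Preadditive.epi_of_cancel_zero _ fun g hg => h g fun j => ?_⟩
  have h₀ : (I j₀).arrow ≫ g = 0 := by
    rw [← cancel_epi (factorThruImageSubobject (c.ι.app j₀)), comp_zero, ← Category.assoc,
      imageSubobject_arrow_comp, hg]
  rw [← imageSubobject_arrow_comp (c.ι.app j), Category.assoc, ← Subobject.ofLE_arrow (hmax j),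
    Category.assoc, h₀, comp_zero, comp_zero]

end Noetherian

/-! ### Direct limits and generated objects -/

section DirectLimits

variable {C : Type u} [Category.{v} C] [Abelian C]

theorem IsNullityClass.inf {P Q : ObjectProperty C} (hP : IsNullityClass P)
    (hQ : IsNullityClass Q) : IsNullityClass (P ⊓ Q) where
  quotients := ⟨fun f _ h =>
    ⟨hP.quotients.prop_of_epi f h.1, hQ.quotients.prop_of_epi f h.2⟩⟩
  extensions := ⟨fun hS h₁ h₃ =>
    ⟨hP.extensions.prop_X₂_of_shortExact hS h₁.1 h₃.1,
      hQ.extensions.prop_X₂_of_shortExact hS h₁.2 h₃.2⟩⟩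

/-- A morphism from a noetherian object to a filtered colimit factors through the image of one of
the objects of the diagram. -/
theorem exists_comp_cokernel_eq_zero [IsGrothendieckAbelian.{w} C] {J : Type w} [SmallCategory J]
    [IsFiltered J] {X K : C} (c : ColimitPresentation J X) (hK : isNoetherianObject K)
    (a : K ⟶ X) : ∃ j, a ≫ cokernel.π (c.ι.app j) = 0 := by
  let β : (Functor.const J).obj K ⟶ (Functor.const J).obj X := (Functor.const J).map a
  -- Exactness of filtered colimits: the pullbacks of the diagram along `a` have a colimit mapping
  -- onto that of the constant diagram at `K`, so one of them already covers `K`.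
  have sq : IsPullback (colim.map (pullback.fst c.ι β)) (colim.map (pullback.snd c.ι β))
      (colim.map c.ι) (colim.map β) := (IsPullback.of_hasPullback c.ι β).map colim
  have hepi : Epi (colim.map c.ι) := by
    refine ⟨fun {Z} g g' h => colimit.hom_ext fun j => ?_⟩
    have hc : ∀ (k : colimit ((Functor.const J).obj X) ⟶ Z) i,
        colimit.ι ((Functor.const J).obj X) i ≫ k = colimit.ι ((Functor.const J).obj X) j ≫ k := by
      intro k i
      rw [← colimit.w ((Functor.const J).obj X) (IsFiltered.leftToMax i j),
        ← colimit.w ((Functor.const J).obj X) (IsFiltered.rightToMax i j)]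
      simp
    refine c.isColimit.hom_ext fun i => ?_
    have := colimit.ι c.diag i ≫= h
    simp only [colim_map, ι_colimMap_assoc] at this
    rwa [hc g i, hc g' i] at this
  have hepi' : Epi (colim.map (pullback.snd c.ι β)) :=
    (MorphismProperty.epimorphisms C).of_isPullback sq hepi
  obtain ⟨j, hj⟩ := exists_epi_of_isNoetherianObject (Cocone.mk K (pullback.snd c.ι β)) hK
    (fun {Z} g hg => by
      let d : colimit ((Functor.const J).obj K) ⟶ Z :=
        colimit.desc _ (Cocone.mk Z ((Functor.const J).map g))
      have hd : d = 0 := by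
        rw [← cancel_epi (colim.map (pullback.snd c.ι β)), comp_zero]
        refine colimit.hom_ext fun j => ?_
        simpa [d] using hg j
      have := IsFiltered.nonempty (C := J)
      have := colimit.ι_desc (Cocone.mk Z ((Functor.const J).map g)) (Classical.arbitrary J)
      change _ ≫ d = g at this
      rw [← this, hd, comp_zero])
  refine ⟨j, ?_⟩
  change Epi ((pullback.snd c.ι β).app j) at hj
  have h := congr_app (pullback.condition (f := c.ι) (g := β)) j
  simp only [NatTrans.comp_app] at h
  change _ = _ ≫ a at h
  rw [← cancel_epi ((pullback.snd c.ι β).app j), ← Category.assoc]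
  erw [← h]
  simp

theorem exists_factorization_of_directLimits [IsGrothendieckAbelian.{w} C] {P : ObjectProperty C}
    (hP : P.IsClosedUnderQuotients) {X K : C} (hX : directLimits.{w} P X)
    (hK : isNoetherianObject K) (a : K ⟶ X) :
    ∃ (B : C) (b : B ⟶ X) (a' : K ⟶ B), P B ∧ a' ≫ b = a := by
  obtain ⟨J, _, _, _, ⟨c⟩⟩ := hX
  obtain ⟨j, hj⟩ := exists_comp_cokernel_eq_zero c.toColimitPresentation hK a
  refine ⟨Abelian.image (c.ι.app j), Abelian.image.ι _, kernel.lift _ a hj,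
    hP.prop_of_epi (Abelian.factorThruImage (c.ι.app j)) (c.prop_diag_obj j), by simp⟩

/-- The objects on which morphisms are detected by precomposition with morphisms
from objects satisfying `P`. -/
def generatedBy (P : ObjectProperty C) : ObjectProperty C :=
  fun X => ∀ ⦃W : C⦄ (f : X ⟶ W), (∀ ⦃A : C⦄ (a : A ⟶ X), P A → a ≫ f = 0) → f = 0

theorem generatedBy_of_directLimits {P : ObjectProperty C} {X : C} (hX : directLimits.{w} P X) :
    generatedBy P X := by
  obtain ⟨J, _, _, _, ⟨c⟩⟩ := hX
  intro W f hf
  refine c.isColimit.hom_ext fun j => ?_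
  rw [comp_zero]
  exact hf _ (c.prop_diag_obj j)

/-- `X` is the union of its subobjects in `P`; these are directed since `P` is closed under binary
sums and quotients. -/
theorem directLimits_of_generatedBy [IsGrothendieckAbelian.{w} C] {P : ObjectProperty C}
    (hP : IsNullityClass P) (h0 : ∃ Z, P Z) {X : C} (hX : generatedBy P X) :
    directLimits.{w} P X := by
  have := hP.quotients
  have := hP.extensions
  obtain ⟨J, ⟨e⟩⟩ :=
    (inferInstance : Small.{w} {S : Subobject X // P (S : C)}).equiv_small
  let s : J → Subobject X := fun j => (e.symm j).1
  let _ : Preorder J := Preorder.lift s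
  have himg : ∀ {A : C} (a : A ⟶ X), P A → ∃ j : J, s j = imageSubobject a := fun a hA =>
    ⟨e ⟨imageSubobject a, P.prop_of_epi (factorThruImageSubobject a) hA⟩, by simp [s]⟩
  have : Nonempty J := by
    obtain ⟨Z, hZ⟩ := h0
    exact ⟨(himg (0 : Z ⟶ X) hZ).choose⟩
  have : IsDirectedOrder J := ⟨fun i j => by
    have hi : P (s i : C) := (e.symm i).2
    have hj : P (s j : C) := (e.symm j).2
    obtain ⟨k, hk⟩ := himg (biprod.desc (s i).arrow (s j).arrow) (P.prop_biprod hi hj)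
    refine ⟨k, ?_, ?_⟩
    · change s i ≤ s k
      rw [hk]
      refine Subobject.le_of_factors ?_
      simpa using imageSubobject_factors_comp_self (f := biprod.desc (s i).arrow (s j).arrow)
        biprod.inl
    · change s j ≤ s k
      rw [hk]
      refine Subobject.le_of_factors ?_
      simpa using imageSubobject_factors_comp_self (f := biprod.desc (s i).arrow (s j).arrow)
        biprod.inr⟩
  let F : J ⥤ MonoOver X := Monotone.functor (f := s) (fun _ _ h => h) ⋙ Subobject.representative
  let G : J ⥤ C := F ⋙ MonoOver.forget _ ⋙ Over.forget _
  let ι : G ⟶ (Functor.const J).obj X :=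
    { app j := (F.obj j).obj.hom
      naturality {i j} g := by simp [G] }
  let f : colimit G ⟶ X := colimit.desc G (Cocone.mk X ι)
  have hf : ∀ j, colimit.ι G j ≫ f = (F.obj j).obj.hom := fun j => colimit.ι_desc _ _
  -- Injectivity of the union is the Grothendieck axiom; surjectivity is generation by `P`.
  have : Mono f := IsGrothendieckAbelian.mono_of_isColimit_monoOver F (colimit.isColimit G) f hf
  have : Epi f := Preadditive.epi_of_cancel_zero _ fun {W} g hg => hX g fun A a hA => by
    obtain ⟨j, hj⟩ := himg a hA
    have h₁ : (s j).arrow ≫ g = 0 := by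
      have h := colimit.ι G j ≫= hg
      rw [comp_zero, ← Category.assoc] at h
      exact (congrArg (· ≫ g) (hf j)).symm.trans h
    have h₂ : (s j).Factors a := by
      rw [hj]
      simpa using imageSubobject_factors_comp_self (f := a) (𝟙 _)
    rw [← (s j).factorThru_arrow a h₂, Category.assoc, h₁, comp_zero]
  have : IsIso f := isIso_of_mono_of_epi f
  exact ⟨J, inferInstance, inferInstance, inferInstance,
    ⟨(ObjectProperty.ColimitOfShape.colimit (P := P) G
      (fun j => (e.symm j).2)).ofIso (asIso f)⟩⟩

theorem directLimits_eq_generatedBy [IsGrothendieckAbelian.{w} C] {P : ObjectProperty C}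
    (hP : IsNullityClass P) (h0 : ∃ Z, P Z) : directLimits.{w} P = generatedBy P :=
  le_antisymm (fun _ h => generatedBy_of_directLimits h)
    (fun _ h => directLimits_of_generatedBy hP h0 h)

theorem le_generatedBy (P : ObjectProperty C) : P ≤ generatedBy P := fun X hX W f hf => by
  simpa using hf (𝟙 X) hX

theorem directLimits_inf_isNoetherianObject {P : ObjectProperty C}
    (hP : P.IsClosedUnderQuotients) {X : C} (hX : directLimits.{w} P X)
    (hX' : isNoetherianObject X) : P X := by
  obtain ⟨J, _, _, _, ⟨c⟩⟩ := hX
  obtain ⟨j, hj⟩ := exists_epi_of_isNoetherianObject c.cocone hX' (fun g hg =>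
    c.isColimit.hom_ext fun j => by rw [comp_zero]; exact hg j)
  exact hP.prop_of_epi (c.ι.app j) (c.prop_diag_obj j)

/-- In a locally noetherian category, an epimorphism onto a noetherian object restricts to an
epimorphism from a noetherian object. -/
theorem exists_isNoetherianObject_epi (hC : IsLocallyNoetherian.{w} C) {E A : C} (p : E ⟶ A)
    [Epi p] (hA : isNoetherianObject A) :
    ∃ (K : C) (k : K ⟶ E), isNoetherianObject K ∧ Epi (k ≫ p) := by
  obtain ⟨ι, G, hG, hsep⟩ := hC
  have : WellFoundedGT (Subobject A) := hA
  let I : Set (Subobject A) :=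
    {Z | ∃ (K : C) (k : K ⟶ E), isNoetherianObject K ∧ Z = imageSubobject (k ≫ p)}
  obtain ⟨_, ⟨K, k, hK, rfl⟩, hmax⟩ := (wellFounded_gt (α := Subobject A)).has_min I
    ⟨_, _, 0, (isNoetherianObject_of_isZero (isZero_zero C)).prop, rfl⟩
  refine ⟨K, k, hK, Preadditive.epi_of_cancel_zero _ fun {Z} g hg => ?_⟩
  rw [← cancel_epi p, comp_zero]
  refine hsep _ _ fun X hX h => ?_
  rw [comp_zero]
  obtain ⟨i⟩ := hX
  -- By maximality, enlarging `K` by a generator does not enlarge its image in `A`.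
  let k' : K ⊞ G i ⟶ E := biprod.desc k h
  have hle : imageSubobject (k ≫ p) ≤ imageSubobject (k' ≫ p) := by
    have : k ≫ p = biprod.inl ≫ k' ≫ p := by simp [k']
    rw [this]
    exact imageSubobject_comp_le _ _
  have := isNullityClass_isNoetherianObject (C := C) |>.extensions
  have heq := hle.eq_of_not_lt (hmax _ ⟨_, k', isNoetherianObject.prop_biprod hK (hG i).prop, rfl⟩)
  have hk : (imageSubobject (k ≫ p)).Factors (h ≫ p) := by
    rw [heq]
    simpa [k'] using imageSubobject_factors_comp_self (f := k' ≫ p) biprod.inr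
  obtain ⟨T, q, _, x, hx⟩ := (imageSubobject_factors_iff _ _).1 hk
  rw [← cancel_epi q, comp_zero, ← Category.assoc h, ← Category.assoc, hx, Category.assoc, hg,
    comp_zero]

end DirectLimits

/-! ### Torsion classes generated by noetherian objects -/

section Torsion

variable {C : Type u} [Category.{v} C] [Abelian C]

theorem isClosedUnderQuotients_generatedBy (P : ObjectProperty C) :
    (generatedBy P).IsClosedUnderQuotients where
  prop_of_epi p _ hX W f hf := by
    rw [← cancel_epi p, comp_zero]
    exact hX _ fun A a hA => by rw [← Category.assoc, hf _ hA]

theorem isClosedUnderColimitsOfShape_generatedBy (P : ObjectProperty C) (J : Type*) [Category* J] :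
    (generatedBy P).IsClosedUnderColimitsOfShape J where
  colimitsOfShape_le := by
    rintro X ⟨c⟩ W f hf
    refine c.isColimit.hom_ext fun j => ?_
    rw [comp_zero]
    exact c.prop_diag_obj j _ fun A a hA => by rw [← Category.assoc, hf _ hA]

/-- Pushing out an epimorphism `p : K ⟶ A` along `l : kernel p ⟶ B`
gives an extension of `A` by `B`. -/
theorem shortExact_of_isPushout_kernel {K A B E : C} {p : K ⟶ A} [Epi p] {l : kernel p ⟶ B}
    {x : K ⟶ E} {y : B ⟶ E} (sq : IsPushout (kernel.ι p) l x y) {g : E ⟶ A} (hx : x ≫ g = p)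
    (hy : y ≫ g = 0) : (ShortComplex.mk y g hy).ShortExact := by
  have hg : Epi g := epi_of_epi_fac hx
  have hy' : Mono y :=
    (MorphismProperty.monomorphisms C).of_isPushout sq.flip (inferInstanceAs (Mono (kernel.ι p)))
  refine ShortComplex.ShortExact.mk' (ShortComplex.exact_of_g_is_cokernel _
    (CokernelCofork.IsColimit.ofπ' g hy fun {T} h hh => ?_)) hy' hg
  have hk : kernel.ι p ≫ x ≫ h = 0 := by rw [sq.w_assoc, hh, comp_zero]
  refine ⟨Abelian.epiDesc p _ hk, sq.hom_ext ?_ ?_⟩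
  · rw [← Category.assoc, hx, Abelian.comp_epiDesc]
  · rw [← Category.assoc, hy, zero_comp, hh]

/-- Each `a : A ⟶ S.X₃` with `A` in `P` lifts to `S.X₂` after an epimorphism from an object of `P`,
itself an extension of `A` by an object of `P`. -/
theorem isClosedUnderExtensions_generatedBy [IsGrothendieckAbelian.{w} C]
    (hC : IsLocallyNoetherian.{w} C) {P : ObjectProperty C} (hP : IsNullityClass P)
    (h0 : ∃ Z, P Z) (hle : P ≤ isNoetherianObject) : (generatedBy P).IsClosedUnderExtensions where
  prop_X₂_of_shortExact {S} hS h₁ h₃ W f hf := by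
    have := hS.mono_f
    have := hS.epi_g
    have hf₁ : S.f ≫ f = 0 := h₁ _ fun A a hA => by rw [← Category.assoc, hf _ hA]
    rw [← hS.exact.g_desc f hf₁]
    suffices hS.exact.desc f hf₁ = 0 by rw [this, comp_zero]
    refine h₃ _ fun A a hA => ?_
    obtain ⟨K, k, hK, hp⟩ := exists_isNoetherianObject_epi hC (pullback.snd S.g a) (hle _ hA)
    let p := k ≫ pullback.snd S.g a
    have hl : (kernel.ι p ≫ k ≫ pullback.fst S.g a) ≫ S.g = 0 := by
      have := kernel.condition p
      simp only [Category.assoc, pullback.condition]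
      simp only [p, ← Category.assoc] at this ⊢
      rw [this, zero_comp]
    -- The kernel of `K ⟶ A` is noetherian but need not lie in `P`; its map to `S.X₁` factors
    -- through some `B` in `P`, and pushing out replaces the kernel by `B`.
    obtain ⟨B, b, l, hB, hlb⟩ := exists_factorization_of_directLimits hP.quotients
      (directLimits_of_generatedBy.{w} hP h0 h₁)
      (isNoetherianObject.prop_of_mono (kernel.ι p) hK) (hS.exact.lift _ hl)
    have : Epi p := hp
    have sq := IsPushout.of_hasPushout (kernel.ι p) l
    let m := sq.desc (k ≫ pullback.fst S.g a) (b ≫ S.f) (by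
      rw [← Category.assoc l, hlb, hS.exact.lift_f])
    let g := sq.desc p 0 (by simp)
    have hx : pushout.inl (kernel.ι p) l ≫ g = p := sq.inl_desc _ _ _
    have hy : pushout.inr (kernel.ι p) l ≫ g = 0 := sq.inr_desc _ _ _
    have hse := shortExact_of_isPushout_kernel sq hx hy
    have : Epi g := hse.epi_g
    have hm : m ≫ S.g = g ≫ a := by
      refine sq.hom_ext ?_ ?_
      · rw [← Category.assoc, ← Category.assoc, hx, sq.inl_desc, Category.assoc,
          pullback.condition, Category.assoc]
      · rw [← Category.assoc, ← Category.assoc, hy, sq.inr_desc, Category.assoc, S.zero,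
          comp_zero, zero_comp]
    rw [← cancel_epi g, comp_zero, ← Category.assoc, ← hm, Category.assoc, hS.exact.g_desc]
    exact hf m (hP.extensions.prop_X₂_of_shortExact hse hB hA)

theorem isTorsionClass_directLimits [IsGrothendieckAbelian.{w} C]
    (hC : IsLocallyNoetherian.{w} C) {P : ObjectProperty C} (hP : IsNullityClass P)
    (h0 : ∃ Z, P Z) (hle : P ≤ isNoetherianObject) :
    IsTorsionClass.{w} (directLimits.{w} P) := by
  rw [directLimits_eq_generatedBy hP h0]
  exact ⟨⟨isClosedUnderQuotients_generatedBy P,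
    isClosedUnderExtensions_generatedBy hC hP h0 hle⟩,
    fun J => isClosedUnderColimitsOfShape_generatedBy P _⟩

theorem directLimits_inf_isNoetherianObject_eq [IsGrothendieckAbelian.{w} C] {P : ObjectProperty C}
    (hP : IsNullityClass P) (h0 : ∃ Z, P Z) (hle : P ≤ isNoetherianObject) :
    directLimits.{w} P ⊓ isNoetherianObject = P :=
  le_antisymm (fun _ h => directLimits_inf_isNoetherianObject hP.quotients h.1 h.2)
    (fun X h => ⟨directLimits_of_generatedBy hP h0 (le_generatedBy P X h), hle X h⟩)

/-- The empty coproduct rules out the empty class, which a nullity class may be. -/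
theorem IsTorsionClass.prop_zero {P : ObjectProperty C}
    (hP : IsTorsionClass.{w} P) {Z : C} (hZ : IsZero Z) : P Z := by
  have := hP.coproducts PEmpty
  exact P.prop_of_isColimit (Cofan.IsColimit.mk
    (Cofan.mk Z (fun j => j.elim) : Cofan (PEmpty.elim : PEmpty.{w + 1} → C)) (fun _ => 0)
    (fun _ j => j.elim) fun _ _ _ => hZ.eq_of_src _ _) (by rintro ⟨⟨⟩⟩)

end Torsion

/-! ### Supports and premonoform quotients -/

section Support

variable {C : Type u} [Category.{v} C] [Abelian C]

theorem isNullityClass_nullityClosure (M : C) : IsNullityClass (nullityClosure M) where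
  quotients := ⟨fun f _ h P hP hM => hP.quotients.prop_of_epi f (h P hP hM)⟩
  extensions := ⟨fun hS h₁ h₃ P hP hM =>
    hP.extensions.prop_X₂_of_shortExact hS (h₁ P hP hM) (h₃ P hP hM)⟩

theorem shortExact_cokernel {X Y : C} (f : X ⟶ Y) [Mono f] :
    (ShortComplex.mk f (cokernel.π f) (cokernel.condition f)).ShortExact :=
  ShortComplex.ShortExact.mk' (ShortComplex.exact_of_g_is_cokernel _ (cokernelIsCokernel f))
    ‹_› (inferInstanceAs (Epi (cokernel.π f)))

theorem shortExact_kernel {X Y : C} (f : X ⟶ Y) [Epi f] :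
    (ShortComplex.mk (kernel.ι f) f (kernel.condition f)).ShortExact :=
  ShortComplex.ShortExact.mk' (ShortComplex.exact_of_f_is_kernel _ (kernelIsKernel f))
    (inferInstanceAs (Mono (kernel.ι f))) ‹_›

theorem IsNullityClass.prop_of_isZero {P : ObjectProperty C} (hP : IsNullityClass P) {M Z : C}
    (hM : P M) (hZ : IsZero Z) : P Z :=
  have : Epi (0 : M ⟶ Z) := ⟨fun _ _ _ => hZ.eq_of_src _ _⟩
  hP.quotients.prop_of_epi (0 : M ⟶ Z) hM

/-- An object that does not lie in a nullity class, all of whose proper quotients do,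
is premonoform. -/
theorem isPremonoform_of_forall_cokernel {P : ObjectProperty C} (hP : IsNullityClass P)
    (h0 : ∃ Z, P Z) {H : C} (hH : ¬ P H)
    (h : ∀ ⦃A : C⦄ (i : A ⟶ H), i ≠ 0 → P (cokernel i)) : IsPremonoform H := by
  refine ⟨fun hz => hH (hP.prop_of_isZero h0.choose_spec hz), fun N ⟨i, _⟩ => ?_⟩
  by_contra! hN
  have hN₀ : N.arrow ≠ 0 := fun e => hN.1 (by
    rw [← Subobject.mk_arrow N]; exact Subobject.mk_eq_bot_iff_zero.2 e)
  have hi : i ≠ 0 := fun e => hN.2 (by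
    have : cokernel.π N.arrow = 0 := by rw [← cancel_mono i, e, comp_zero, comp_zero]
    have := Preadditive.epi_of_cokernel_zero this
    rw [← Subobject.mk_arrow N]
    exact (Subobject.epi_iff_mk_eq_top _).1 this)
  -- The embedding `i` of `H/N` exhibits `H` as an extension of `cokernel i` by `H/N`, both in `P`.
  exact hH (hP.extensions.prop_X₂_of_shortExact (shortExact_cokernel i) (h _ hN₀) (h _ hi))

/-- Take `H = Q/N` with `N` maximal among the subobjects whose quotient is outside `P`. -/
theorem exists_isPremonoform_quotient {P : ObjectProperty C} (hP : IsNullityClass P)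
    (h0 : ∃ Z, P Z) {Q : C} (hQ : isNoetherianObject Q) (hPQ : ¬ P Q) :
    ∃ (H : C) (q : Q ⟶ H), Epi q ∧ IsPremonoform H ∧ ¬ P H := by
  have : WellFoundedGT (Subobject Q) := hQ
  have := hP.quotients
  obtain ⟨N, hN, hmax⟩ := (wellFounded_gt (α := Subobject Q)).has_min
    {N | ¬ P (cokernel N.arrow)} ⟨⊥, fun h => hPQ (by
      have h₀ : (⊥ : Subobject Q).arrow ≫ 𝟙 Q = 0 := by simp
      have := epi_of_epi_fac (cokernel.π_desc _ _ h₀)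
      exact P.prop_of_epi (cokernel.desc _ (𝟙 Q) h₀) h)⟩
  refine ⟨_, cokernel.π N.arrow, inferInstance,
    isPremonoform_of_forall_cokernel hP h0 hN fun A i hi => ?_, hN⟩
  let π := cokernel.π N.arrow ≫ cokernel.π i
  by_contra hPi
  have hle : N ≤ kernelSubobject π := le_kernelSubobject _ _ (by simp [π])
  have hmem : ¬ P (cokernel (kernelSubobject π).arrow) := fun h => hPi (by
    have e : cokernel.π (kernelSubobject π).arrow ≫ cokernel.desc (kernelSubobject π).arrow π
      (kernelSubobject_arrow_comp π) = π := by simp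
    have := epi_of_epi_fac e
    exact P.prop_of_epi (cokernel.desc _ π (kernelSubobject_arrow_comp π)) h)
  have heq := hle.eq_of_not_lt (hmax _ hmem)
  obtain ⟨T, p, _, x, hx⟩ := surjective_up_to_refinements_of_epi (cokernel.π N.arrow) i
  have hxN : N.Factors x := by
    rw [heq, kernelSubobject_factors_iff]
    dsimp only [π]
    rw [← Category.assoc, ← hx, Category.assoc, cokernel.condition, comp_zero]
  rw [subobject_factors_iff, ← hx] at hxN
  exact hi (by rw [← cancel_epi p, hxN, comp_zero])

/-- The objects all of whose noetherian quotients satisfy `P`. -/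
def noetherianQuotientsIn (P : ObjectProperty C) : ObjectProperty C :=
  fun M => ∀ ⦃Q : C⦄ (f : M ⟶ Q) [Epi f], isNoetherianObject Q → P Q

/-- A noetherian quotient `Q` of `S.X₂` is an extension of a quotient of `S.X₃` by the image of
`S.X₁`; both are noetherian. -/
theorem isNullityClass_noetherianQuotientsIn {P : ObjectProperty C} (hP : IsNullityClass P) :
    IsNullityClass (noetherianQuotientsIn P) where
  quotients := ⟨fun p _ h Q f _ hQ => h (p ≫ f) hQ⟩
  extensions := ⟨fun {S} hS h₁ h₃ Q f _ hQ => by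
    have := hS.epi_g
    have hg : S.f ≫ f ≫ cokernel.π (S.f ≫ f) = 0 := by
      rw [← Category.assoc, cokernel.condition]
    have e := hS.exact.g_desc _ hg
    have : Epi (hS.exact.desc _ hg) := epi_of_epi_fac e
    exact hP.extensions.prop_X₂_of_shortExact (shortExact_kernel (cokernel.π (S.f ≫ f)))
      (h₁ (Abelian.factorThruImage (S.f ≫ f))
        (isNoetherianObject.prop_of_mono (Abelian.image.ι (S.f ≫ f)) hQ))
      (h₃ (hS.exact.desc _ hg) (isNoetherianObject_of_epi (cokernel.π (S.f ≫ f)) hQ))⟩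

theorem noetherianQuotientsIn_inf {P : ObjectProperty C} (hP : IsNullityClass P) :
    noetherianQuotientsIn P ⊓ isNoetherianObject = P ⊓ isNoetherianObject :=
  le_antisymm (fun _ h => ⟨h.1 (𝟙 _) h.2, h.2⟩)
    (fun _ h => ⟨fun _ f _ _ => hP.quotients.prop_of_epi f h.1, h.2⟩)

theorem npsupp_subset_of_nullityClosure {M N : C} (h : nullityClosure M N) :
    npsupp N ⊆ npsupp M := by
  rintro ⟨_, hp⟩ ⟨H, hH, rfl, hNH⟩
  exact ⟨H, hH, rfl, nullityClosure_trans h hNH⟩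

theorem npsuppInv_npsuppOf {P : ObjectProperty C} (hP : IsNullityClass P) (h0 : ∃ Z, P Z) :
    npsuppInv (npsuppOf P) = noetherianQuotientsIn P := by
  ext M
  constructor
  · intro hM Q f _ hQ
    by_contra hPQ
    obtain ⟨H, q, _, hH, hPH⟩ := exists_isPremonoform_quotient hP h0 hQ hPQ
    have hMH : nullityClosure M H :=
      (isNullityClass_nullityClosure M).quotients.prop_of_epi (f ≫ q) (nullityClosure_self M)
    obtain ⟨M', hM', h⟩ := @hM ⟨PSpec.mk H hH, H, hH, ⟨isNoetherianObject_of_epi q hQ⟩, rfl⟩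
      ((PSpec.mk_mem_psupp_iff hH).2 hMH)
    exact hPH ((PSpec.mk_mem_psupp_iff hH).1 h P hP hM')
  · rintro hM ⟨_, H, hH, hHn, rfl⟩ hp
    -- `H` inherits the property from `M`, and being noetherian is its own noetherian quotient.
    have := (PSpec.mk_mem_psupp_iff hH).1 hp _ (isNullityClass_noetherianQuotientsIn hP) hM
    exact ⟨H, this (𝟙 H) hHn.prop, (PSpec.mk_mem_psupp_iff hH).2 (nullityClosure_self H)⟩

theorem isClosed_npsuppOf (P : ObjectProperty C) : IsClosed (npsuppOf P) := by
  rw [NPSpec.isClosed_iff]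
  rintro ⟨_, hp⟩ ⟨M, hM, h⟩ H hH rfl q hq
  exact ⟨M, hM, npsupp_subset_of_nullityClosure ((PSpec.mk_mem_psupp_iff hH).1 h) hq⟩

theorem isExtensionClosed_npsuppOf {P : ObjectProperty C} (hP : IsNullityClass P)
    (h0 : ∃ Z, P Z) : IsExtensionClosed (npsuppOf P) := by
  rw [IsExtensionClosed, npsuppInv_npsuppOf hP h0]
  exact (isNullityClass_noetherianQuotientsIn hP).extensions

theorem isNullityClass_npsuppInv {Φ : Set (NPSpec C)} (hΦ : IsExtensionClosed Φ) :
    IsNullityClass (npsuppInv Φ) where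
  quotients := ⟨fun {M _} f _ h => (npsupp_subset_of_nullityClosure
    ((isNullityClass_nullityClosure M).quotients.prop_of_epi f (nullityClosure_self M))).trans h⟩
  extensions := hΦ

/-- Zero objects form a nullity class, which contains no premonoform object. -/
theorem npsuppInv_of_isZero (Φ : Set (NPSpec C)) {Z : C} (hZ : IsZero Z) : npsuppInv Φ Z := by
  rintro _ ⟨H, hH, -, hZH⟩
  refine (hH.1 (hZH IsZero ⟨⟨fun f _ h => ?_⟩, ⟨fun hS h₁ h₃ => ?_⟩⟩ hZ)).elim
  · exact h.of_epi f
  · exact hS.exact.isZero_X₂ (h₁.eq_of_src _ _) (h₃.eq_of_tgt _ _)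

theorem npsuppOf_directLimits_npsuppInv [IsGrothendieckAbelian.{w} C]
    (hC : IsLocallyNoetherian.{w} C) {Φ : Set (NPSpec C)} (hΦ : IsClosed Φ)
    (hΦ' : IsExtensionClosed Φ) :
    npsuppOf (directLimits.{w} (npsuppInv Φ ⊓ isNoetherianObject)) = Φ := by
  have hP := (isNullityClass_npsuppInv hΦ').inf isNullityClass_isNoetherianObject
  obtain ⟨Z, hZ⟩ := HasZeroObject.zero (C := C)
  have h0 : ∃ Z, (npsuppInv Φ ⊓ isNoetherianObject) Z :=
    ⟨Z, npsuppInv_of_isZero Φ hZ, (isNoetherianObject_of_isZero hZ).prop⟩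
  refine Set.Subset.antisymm ?_ ?_
  · rintro ⟨_, H, hH, hHn, rfl⟩ ⟨M, hM, h⟩
    have := (PSpec.mk_mem_psupp_iff hH).1 h _
      (isTorsionClass_directLimits hC hP h0 inf_le_right).nullity hM
    exact (directLimits_inf_isNoetherianObject hP.quotients this hHn.prop).1
      ((PSpec.mk_mem_psupp_iff hH).2 (nullityClosure_self H))
  · rintro ⟨_, H, hH, hHn, rfl⟩ hp
    exact ⟨H, directLimits_of_generatedBy hP h0 (le_generatedBy _ _
      ⟨(NPSpec.isClosed_iff Φ).1 hΦ _ hp H hH rfl, hHn.prop⟩),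
      (PSpec.mk_mem_psupp_iff hH).2 (nullityClosure_self H)⟩

end Support

end PremonoformSpectrum

open PremonoformSpectrum
theorem mainTheorem2 (C : Type u) [Category.{v} C] [Abelian C] [IsGrothendieckAbelian.{w} C]
    (hC : IsLocallyNoetherian.{w} C) :
    ∃ e : {X : ObjectProperty C // IsTorsionClass.{w} X ∧ IsOfWeaklyFiniteType.{w} X} ≃
        {Φ : Set (NPSpec C) // IsClosed Φ ∧ IsExtensionClosed Φ},
      (∀ X, (e X).1 = npsuppOf X.1) ∧
      (∀ Φ, (e.symm Φ).1 = directLimits.{w} (npsuppInv Φ.1 ⊓ isNoetherianObject)) := by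
  obtain ⟨Z, hZ⟩ := HasZeroObject.zero (C := C)
  have h0 : ∀ Φ : Set (NPSpec C), ∃ Z, (npsuppInv Φ ⊓ isNoetherianObject) Z := fun Φ =>
    ⟨Z, npsuppInv_of_isZero Φ hZ, (isNoetherianObject_of_isZero hZ).prop⟩
  have hnull : ∀ Φ : Set (NPSpec C), IsExtensionClosed Φ →
      IsNullityClass (npsuppInv Φ ⊓ isNoetherianObject) := fun Φ hΦ =>
    (isNullityClass_npsuppInv hΦ).inf isNullityClass_isNoetherianObject
  refine ⟨⟨fun X => ⟨npsuppOf X.1, isClosed_npsuppOf _,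
      isExtensionClosed_npsuppOf X.2.1.nullity ⟨Z, X.2.1.prop_zero hZ⟩⟩,
    fun Φ => ⟨directLimits.{w} (npsuppInv Φ.1 ⊓ isNoetherianObject),
      isTorsionClass_directLimits hC (hnull _ Φ.2.2) (h0 _) inf_le_right, ?_⟩, ?_, ?_⟩,
    fun _ => rfl, fun _ => rfl⟩
  · rw [IsOfWeaklyFiniteType,
      directLimits_inf_isNoetherianObject_eq (hnull _ Φ.2.2) (h0 _) inf_le_right]
  · rintro ⟨X, hX, hX'⟩
    refine Subtype.ext ?_
    change directLimits.{w} (npsuppInv (npsuppOf X) ⊓ isNoetherianObject) = X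
    -- The two classes share their noetherian objects, and weakly finite type rebuilds `X` from
    -- these.
    rw [npsuppInv_npsuppOf hX.nullity ⟨Z, hX.prop_zero hZ⟩, noetherianQuotientsIn_inf hX.nullity]
    exact hX'.symm
  · rintro ⟨Φ, hΦ, hΦ'⟩
    exact Subtype.ext (npsuppOf_directLimits_npsuppInv hC hΦ hΦ')
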